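/- A latency function is a non-decreasing function $f:\mathbb{R}_{>0}\to\mathbb{R}_{>0}$, extended by $f(0)=\lim_{x\to 0^+}f(x)$. A weighted congestion game consists of a finite set $N$ of at least two players with weights $w_i\ge 0$, not all zero, a finite set $E$ of resources with latency functions $(\ell_e)_{e\in E}$, and for each player $i$ a non-empty family $\Sigma_i$ of non-empty subsets of $E$ (her strategies). In a strategy profile $\sigma=(\sigma_i)_{i\in N}$, $\sigma_i\in\Sigma_i$, let $k_e(\sigma)=\sum_{i:e\in\sigma_i}w_i$, $cost_i(\sigma)=\sum_{e\in\sigma_i}\ell_e(k_e(\sigma))$ and $\mathrm{SUM}(\sigma)=\sum_{i\in N}w_i\,cost_i(\sigma)$. For $\epsilon\ge 0$, $\sigma$ is an $\epsilon$-approximate pure Nash equilibrium if $cost_i(\sigma)\le(1+\epsilon)\,cost_i(\sigma_{-i},S)$ for every player $i$ and every $S\in\Sigma_i$. The $\epsilon$-approximate price of anarchy $\mathrm{PoA}_\epsilon$ of a game is the maximum of $\mathrm{SUM}(\sigma)/\mathrm{SUM}(\sigma^*)$ over its $\epsilon$-approximate pure Nash equilibria $\sigma$, where $\sigma^*$ is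 a profile minimizing $\mathrm{SUM}$; for a class $\mathcal{G}$ of games, $\mathrm{PoA}_\epsilon(\mathcal{G})$ is the supremum of $\mathrm{PoA}_\epsilon$ over the games in $\mathcal{G}$ (games without such equilibria do not contribute). A game is load balancing if all strategies are singletons, and symmetric if all players have the same strategy set. For a class $\mathcal{C}$ of latency functions, let $\mathsf{W}(\mathcal{C})$, $\mathsf{WLB}(\mathcal{C})$ and $\mathsf{WSLB}(\mathcal{C})$ be the classes of weighted congestion games, of weighted load balancing games, and of weighted symmetric load balancing games, whose latency functions all belong to $\mathcal{C}$. For a class $\mathcal{G}$ of weighted congestion games whose latency functions form the class $\mathcal{C}(\mathcal{G})$, let $$\gamma_{\mathsf W}(\mathrm{PoA}_\epsilon,\mathcal{G})=\inf_{x\ge 1}\ \sup_{f\in\mathcal{C}(\mathcal{G}),\,k>0,\,o>0}\frac{kf(k)+x\bigl(-kf(k)+(1+\epsilon)\,o f(k+o)\bigr)}{o f(o)}\in[-\infty,\infty].$$ **Theorem.** Let $\epsilon\ge 0$ and let $\mathcal{C}$ be a class of latency functions that contains a non-constant function and is closed under ordinate scaling and abscissa scaling, that is, for all $f\in\mathcal{C}$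 and $\alpha>0$ the functions $x\mapsto\alpha f(x)$ and $x\mapsto f(\alpha x)$ belong to $\mathcal{C}$. Then $$\gamma_{\mathsf W}(\mathrm{PoA}_\epsilon,\mathsf{W}(\mathcal{C}))=\mathrm{PoA}_\epsilon(\mathsf{W}(\mathcal{C}))=\mathrm{PoA}_\epsilon(\mathsf{WLB}(\mathcal{C})).$$ If moreover every non-constant $f\in\mathcal{C}$ is unbounded, i.e. $\lim_{x\to\infty}f(x)=\infty$, then $$\gamma_{\mathsf W}(\mathrm{PoA}_\epsilon,\mathsf{W}(\mathcal{C}))=\mathrm{PoA}_\epsilon(\mathsf{W}(\mathcal{C}))=\mathrm{PoA}_\epsilon(\mathsf{WSLB}(\mathcal{C})).$$ The values may be $+\infty$. -/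

import Mathlib

open scoped NNReal

/-- A latency function `ℝ_{>0} → ℝ_{>0}`: positive on positive congestions, non-decreasing, and
extended to `0` by its right limit there (continuity at `0` in `ℝ≥0` says exactly this). -/
structure IsLatency (f : ℝ≥0 → ℝ≥0) : Prop where
  pos : ∀ x, 0 < x → 0 < f x
  mono : Monotone f
  zero : ContinuousAt f 0

/-- A function is constant. -/
def IsConstantLatency (f : ℝ≥0 → ℝ≥0) : Prop := ∃ c, ∀ x, f x = c

/-- A latency function is unbounded if it tends to infinity at infinity. -/
def IsUnboundedLatency (f : ℝ≥0 → ℝ≥0) : Prop := Filter.Tendsto f Filter.atTop Filter.atTop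

/-- `α • f` belongs to the class for every `f` in the class and every `α > 0`. -/
def ClosedUnderOrdinateScaling (C : Set (ℝ≥0 → ℝ≥0)) : Prop :=
  ∀ f ∈ C, ∀ α : ℝ≥0, 0 < α → (fun x => α * f x) ∈ C

/-- `x ↦ f (α x)` belongs to the class for every `f` in the class and every `α > 0`. -/
def ClosedUnderAbscissaScaling (C : Set (ℝ≥0 → ℝ≥0)) : Prop :=
  ∀ f ∈ C, ∀ α : ℝ≥0, 0 < α → (fun x => f (α * x)) ∈ C

/-- A (finite) weighted congestion game with at least two players, not all of weight zero. -/
structure CongestionGame where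
  Player : Type
  Resource : Type
  [fintypePlayer : Fintype Player]
  [decEqPlayer : DecidableEq Player]
  [fintypeResource : Fintype Resource]
  [decEqResource : DecidableEq Resource]
  two_le_card : 2 ≤ Fintype.card Player
  latency : Resource → ℝ≥0 → ℝ≥0
  isLatency : ∀ e, IsLatency (latency e)
  weight : Player → ℝ≥0
  exists_weight_pos : ∃ i, 0 < weight i
  /-- The strategy set of each player: a non-empty family of non-empty sets of resources. -/
  strategies : Player → Set (Finset Resource)
  strategies_nonempty : ∀ i, (strategies i).Nonempty
  nonempty_of_mem : ∀ i, ∀ S ∈ strategies i, S.Nonempty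

namespace CongestionGame

attribute [instance] fintypePlayer decEqPlayer fintypeResource decEqResource

/-- Strategy profiles: each player plays one of her strategies. -/
def IsProfile (Γ : CongestionGame) (σ : Γ.Player → Finset Γ.Resource) : Prop :=
  ∀ i, σ i ∈ Γ.strategies i

/-- The congestion of a resource: the total weight of the players using it. -/
def congestion (Γ : CongestionGame) (σ : Γ.Player → Finset Γ.Resource) (e : Γ.Resource) : ℝ≥0 :=
  ∑ i ∈ Finset.univ.filter (fun i => e ∈ σ i), Γ.weight i

/-- The personal cost of a player. -/
def cost (Γ : CongestionGame) (σ : Γ.Player → Finset Γ.Resource) (i : Γ.Player) : ℝ≥0 :=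
  ∑ e ∈ σ i, Γ.latency e (Γ.congestion σ e)

/-- The social function: the weighted sum of the personal costs. -/
def socialCost (Γ : CongestionGame) (σ : Γ.Player → Finset Γ.Resource) : ℝ≥0 :=
  ∑ i, Γ.weight i * Γ.cost σ i

/-- A social optimum: a strategy profile of minimum social cost. -/
def IsSocialOptimum (Γ : CongestionGame) (σ : Γ.Player → Finset Γ.Resource) : Prop :=
  Γ.IsProfile σ ∧ ∀ τ, Γ.IsProfile τ → Γ.socialCost σ ≤ Γ.socialCost τ

/-- An `ε`-approximate pure Nash equilibrium. -/
def IsApproxNash (Γ : CongestionGame) (ε : ℝ≥0) (σ : Γ.Player → Finset Γ.Resource) : Prop :=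
  Γ.IsProfile σ ∧
    ∀ i, ∀ S ∈ Γ.strategies i, Γ.cost σ i ≤ (1 + ε) * Γ.cost (Function.update σ i S) i

/-- All players share the same strategy set. -/
def IsSymmetric (Γ : CongestionGame) : Prop := ∀ i j, Γ.strategies i = Γ.strategies j

/-- All strategies are singletons. -/
def IsLoadBalancing (Γ : CongestionGame) : Prop := ∀ i, ∀ S ∈ Γ.strategies i, S.card = 1

/-- The `ε`-approximate price of anarchy of a game: the largest ratio between the social cost of an
`ε`-approximate pure Nash equilibrium and the social cost of a social optimum. A game without
such equilibria gets the value `⊥`, so that it does not contribute to suprema over classes. -/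
noncomputable def approxPoA (Γ : CongestionGame) (ε : ℝ≥0) : EReal :=
  ⨆ (σ : Γ.Player → Finset Γ.Resource) (_ : Γ.IsApproxNash ε σ)
    (τ : Γ.Player → Finset Γ.Resource) (_ : Γ.IsSocialOptimum τ),
    (((Γ.socialCost σ : ℝ) / (Γ.socialCost τ : ℝ) : ℝ) : EReal)

end CongestionGame

/-- The `ε`-approximate price of anarchy of a class of games. -/
noncomputable def classApproxPoA (ε : ℝ≥0) (G : Set CongestionGame) : EReal :=
  ⨆ Γ ∈ G, CongestionGame.approxPoA Γ ε

/-- The weighted congestion games with latency functions in `C`. -/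
def weightedGames (C : Set (ℝ≥0 → ℝ≥0)) : Set CongestionGame :=
  {Γ | ∀ e, Γ.latency e ∈ C}

/-- The weighted load balancing games with latency functions in `C`. -/
def weightedLoadBalancingGames (C : Set (ℝ≥0 → ℝ≥0)) : Set CongestionGame :=
  {Γ | Γ ∈ weightedGames C ∧ Γ.IsLoadBalancing}

/-- The weighted symmetric load balancing games with latency functions in `C`. -/
def weightedSymmetricLoadBalancingGames (C : Set (ℝ≥0 → ℝ≥0)) : Set CongestionGame :=
  {Γ | Γ ∈ weightedGames C ∧ Γ.IsLoadBalancing ∧ Γ.IsSymmetric}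

/-- The class of latency functions occurring in the games of a class. -/
def latencyClass (G : Set CongestionGame) : Set (ℝ≥0 → ℝ≥0) :=
  {f | ∃ Γ ∈ G, ∃ e, CongestionGame.latency Γ e = f}

/-- `β_W(PoA_ε, k, o, f) = -k f(k) + (1 + ε) o f(k + o)`. -/
noncomputable def betaW (ε k o : ℝ≥0) (f : ℝ≥0 → ℝ≥0) : ℝ :=
  -((k : ℝ) * f k) + (1 + (ε : ℝ)) * (o * f (k + o))

/-- `γ_W(PoA_ε, x, k, o, f) = (k f(k) + x β_W(PoA_ε, k, o, f)) / (o f(o))`. -/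
noncomputable def gammaWTuple (ε : ℝ≥0) (x : ℝ) (k o : ℝ≥0) (f : ℝ≥0 → ℝ≥0) : ℝ :=
  ((k : ℝ) * f k + x * betaW ε k o f) / ((o : ℝ) * f o)

/-- `γ_W(PoA_ε, G)`: the infimum over `x ≥ 1` of the supremum over the latency functions `f` of the
games in `G` and over `k, o > 0` of `γ_W(PoA_ε, x, k, o, f)`. -/
noncomputable def gammaW (ε : ℝ≥0) (G : Set CongestionGame) : EReal :=
  ⨅ (x : ℝ) (_ : 1 ≤ x),
    ⨆ (f : ℝ≥0 → ℝ≥0) (_ : f ∈ latencyClass G) (k : ℝ≥0) (_ : 0 < k) (o : ℝ≥0) (_ : 0 < o),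
      ((gammaWTuple ε x k o f : ℝ) : EReal)

/-!
The upper bound on the price of anarchy is a smoothness argument. Let `σ` be an `ε`-approximate
equilibrium and `τ` an optimum, with congestions `k_e` and `o_e`. Summing the equilibrium
inequalities for the deviations to `τ`, weighted by the weights of the players, gives
`0 ≤ ∑ e, betaW ε k_e o_e ℓ_e`; adding `x ≥ 1` times this to the social cost of `σ` and bounding
each resource separately yields `classApproxPoA_le_gammaW`.

For the lower bound let `M < gammaW`. A tuple `(f, k, o)` defines the line
`x ↦ gammaWTuple ε x k o f` with slope `betaW / (o f(o))`, and by hypothesis at each `x ≥ 1` some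
line exceeds `M`. By one-dimensional duality (`exists_multiplier`), at a single `x` one
non-increasing and one non-decreasing line exceed `M` (only the latter is needed if `x = 1`).

The game lives on a complete `n`-ary tree: nodes are resources, edges are players, and an edge uses
its upper end in the equilibrium and its lower end in a cheap profile. Scaling the two chosen
functions level by level makes each node see congestion `k` in the equilibrium and `o` in the cheap
profile, and makes moving one level down exactly unprofitable. If `P` and `P'` are the equilibrium
costs of consecutive levels and `Q` is the cheap cost of the upper one, then
`M Q + δ P ≤ P' + x (P - P')` for a constant `δ > 0`. This telescopes. Taking first many levels with
the tuple of the non-increasing line, along which `P` grows, and then many levels with the other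
one, along which `P` decreases, makes the slack `δ P` absorb both ends (`mul_sum_le_sum_of_steps`),
so the ratio of the two social costs is at least `M` (`IsLevelData.le_approxPoA`).

If every edge may choose only its two ends, this is an equilibrium for every `n`. If all nodes are
open to all players, moving up is unprofitable because costs decrease down the tree, and moving
several levels down is unprofitable for large `n` if the latencies are unbounded: the weights then
shrink so fast that the deviating player is too heavy (`IsLevelData.exists_cost_le_deviation`).
Constant functions can be avoided here because they contribute to `gammaW` no more than what a
non-constant function contributes as `k / o` tends to `0`.
-/

/-! ### The upper bound -/

theorem sub_le_gammaWTuple {f : ℝ≥0 → ℝ≥0} (hf : IsLatency f) (ε : ℝ≥0) {x : ℝ} (hx : 1 ≤ x)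
    {o t : ℝ≥0} (ho : 0 < o) (ht : t ≤ 1) :
    x * (1 + ε) - (x - 1) * t ≤ gammaWTuple ε x (o * t) o f := by
  have hfo : (0 : ℝ) < f o := by exact_mod_cast hf.pos o ho
  have ho' : (0 : ℝ) < o := by exact_mod_cast ho
  have h1 : (f (o * t) : ℝ) ≤ f o := by
    exact_mod_cast hf.mono (mul_le_of_le_one_right' ht)
  have h2 : (f o : ℝ) ≤ f (o * t + o) := by exact_mod_cast hf.mono le_add_self
  have ht0 : (0 : ℝ) ≤ t := t.2
  have he : (0 : ℝ) ≤ ε := ε.2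
  rw [gammaWTuple, betaW, le_div_iff₀ (by positivity)]
  push_cast
  have e1 : (x - 1) * (o * t * f (o * t)) ≤ (x - 1) * (o * t * f o) := by
    have : 0 ≤ x - 1 := by linarith
    gcongr
  have e2 : x * ((1 + ε) * (o * f o)) ≤ x * ((1 + ε) * (o * f (o * t + o))) := by
    gcongr
  linarith

/-- The bound defining `gammaW` extends from positive congestions to all congestions. For `o = 0`
this needs `1 ≤ x`; for `k = 0` it follows by letting `k` tend to `0`. -/
theorem add_mul_betaW_le {f : ℝ≥0 → ℝ≥0} (hf : IsLatency f) {ε : ℝ≥0} {x s : ℝ} (hx : 1 ≤ x)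
    (hs : ∀ k > 0, ∀ o > 0, gammaWTuple ε x k o f ≤ s) (k o : ℝ≥0) :
    (k : ℝ) * f k + x * betaW ε k o f ≤ s * (o * f o) := by
  rcases eq_or_ne o 0 with rfl | ho
  · have : 0 ≤ (k : ℝ) * f k := by positivity
    simp only [betaW, NNReal.coe_zero, zero_mul, mul_zero, add_zero]
    nlinarith
  have ho : 0 < o := pos_iff_ne_zero.2 ho
  have hfo : (0 : ℝ) < f o := by exact_mod_cast hf.pos o ho
  have ho' : (0 : ℝ) < o := by exact_mod_cast ho
  rcases eq_or_ne k 0 with rfl | hk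
  · have key : x * (1 + ε) ≤ s := by
      have hlim : Filter.Tendsto (fun t : ℝ≥0 => x * (1 + ε) - (x - 1) * (t : ℝ))
          (nhdsWithin 0 (Set.Ioi 0)) (nhds (x * (1 + ε) - (x - 1) * ((0 : ℝ≥0) : ℝ))) := by
        apply Filter.Tendsto.mono_left _ nhdsWithin_le_nhds
        exact Continuous.tendsto (by fun_prop) 0
      have := le_of_tendsto hlim (b := s) (by
        filter_upwards [self_mem_nhdsWithin,
          nhdsWithin_le_nhds (Iic_mem_nhds (zero_lt_one (α := ℝ≥0)))] with t ht ht1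
        exact (sub_le_gammaWTuple hf ε hx ho ht1).trans (hs _ (mul_pos ho ht) _ ho))
      simpa using this
    have : 0 < (o : ℝ) * f o := by positivity
    simp only [betaW, NNReal.coe_zero, zero_mul, zero_add, neg_zero]
    nlinarith
  · have := hs k (pos_iff_ne_zero.2 hk) o ho
    rwa [gammaWTuple, div_le_iff₀ (by positivity)] at this

namespace CongestionGame

variable (Γ : CongestionGame)

theorem sum_weight_mul_sum (σ : Γ.Player → Finset Γ.Resource) (g : Γ.Resource → ℝ≥0) :
    ∑ i, Γ.weight i * ∑ e ∈ σ i, g e = ∑ e, Γ.congestion σ e * g e := by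
  simp_rw [congestion, Finset.sum_filter, Finset.sum_mul, Finset.mul_sum]
  rw [Finset.sum_comm]
  refine Finset.sum_congr rfl fun i _ => ?_
  simp only [ite_mul, zero_mul]
  rw [← Finset.sum_filter]
  simp

theorem congestion_update_le (σ : Γ.Player → Finset Γ.Resource) (i : Γ.Player)
    (S : Finset Γ.Resource) (e : Γ.Resource) :
    Γ.congestion (Function.update σ i S) e ≤ Γ.congestion σ e + Γ.weight i := by
  have hsub : (Finset.univ.filter fun j => e ∈ Function.update σ i S j) ⊆
      insert i (Finset.univ.filter fun j => e ∈ σ j) := by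
    intro j
    by_cases hj : j = i
    · simp [hj]
    · simpa [Function.update_of_ne hj] using Or.inr
  refine (Finset.sum_le_sum_of_subset hsub).trans ?_
  by_cases hi : i ∈ Finset.univ.filter fun j => e ∈ σ j
  · rw [Finset.insert_eq_of_mem hi]
    exact le_self_add
  · rw [Finset.sum_insert hi, add_comm]
    rfl

theorem weight_le_congestion {τ : Γ.Player → Finset Γ.Resource} {i : Γ.Player} {e : Γ.Resource}
    (h : e ∈ τ i) : Γ.weight i ≤ Γ.congestion τ e :=
  Finset.single_le_sum (f := Γ.weight) (fun _ _ => zero_le) (by simpa using h)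

variable {Γ}

theorem IsApproxNash.socialCost_le {ε : ℝ≥0} {σ τ : Γ.Player → Finset Γ.Resource}
    (hσ : Γ.IsApproxNash ε σ) (hτ : Γ.IsProfile τ) :
    Γ.socialCost σ ≤ (1 + ε) * ∑ e, Γ.congestion τ e *
      Γ.latency e (Γ.congestion σ e + Γ.congestion τ e) := by
  rw [← sum_weight_mul_sum, Finset.mul_sum]
  refine Finset.sum_le_sum fun i _ => ?_
  rw [mul_left_comm]
  gcongr
  refine (hσ.2 i (τ i) (hτ i)).trans ?_
  gcongr
  rw [cost, Function.update_self]
  refine Finset.sum_le_sum fun e he => (Γ.isLatency e).mono ?_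
  refine (Γ.congestion_update_le σ i (τ i) e).trans ?_
  gcongr
  exact Γ.weight_le_congestion he

theorem IsProfile.socialCost_pos {τ : Γ.Player → Finset Γ.Resource} (hτ : Γ.IsProfile τ) :
    0 < Γ.socialCost τ := by
  obtain ⟨i, hi⟩ := Γ.exists_weight_pos
  obtain ⟨e, he⟩ := Γ.nonempty_of_mem i _ (hτ i)
  refine lt_of_lt_of_le ?_
    (Finset.single_le_sum (f := fun i => Γ.weight i * Γ.cost τ i) (fun _ _ => zero_le)
      (Finset.mem_univ i))
  refine mul_pos hi (lt_of_lt_of_le ?_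
    (Finset.single_le_sum (f := fun e => Γ.latency e (Γ.congestion τ e)) (fun _ _ => zero_le) he))
  exact (Γ.isLatency e).pos _ (hi.trans_le (Γ.weight_le_congestion he))

theorem socialCost_eq_sum (σ : Γ.Player → Finset Γ.Resource) :
    Γ.socialCost σ = ∑ e, Γ.congestion σ e * Γ.latency e (Γ.congestion σ e) :=
  Γ.sum_weight_mul_sum σ _

/-- The smoothness argument: the equilibrium inequalities, summed with multiplier `x`, compare the
two social costs resource by resource. -/
theorem IsApproxNash.socialCost_le_mul {ε : ℝ≥0} {σ τ : Γ.Player → Finset Γ.Resource}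
    (hσ : Γ.IsApproxNash ε σ) (hτ : Γ.IsProfile τ) {x s : ℝ} (hx : 1 ≤ x)
    (hs : ∀ e, ∀ k > 0, ∀ o > 0, gammaWTuple ε x k o (Γ.latency e) ≤ s) :
    (Γ.socialCost σ : ℝ) ≤ s * Γ.socialCost τ := by
  have h1 : (0 : ℝ) ≤
      ∑ e, betaW ε (Γ.congestion σ e) (Γ.congestion τ e) (Γ.latency e) := by
    have := hσ.socialCost_le hτ
    rw [socialCost_eq_sum, ← NNReal.coe_le_coe] at this
    push_cast at this
    simp only [betaW, Finset.sum_add_distrib, Finset.sum_neg_distrib, ← Finset.mul_sum]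
    linarith
  rw [socialCost_eq_sum, socialCost_eq_sum]
  push_cast
  calc ∑ e, (Γ.congestion σ e : ℝ) * Γ.latency e (Γ.congestion σ e)
      ≤ ∑ e, (Γ.congestion σ e : ℝ) * Γ.latency e (Γ.congestion σ e) +
        x * ∑ e, betaW ε (Γ.congestion σ e) (Γ.congestion τ e) (Γ.latency e) :=
        le_add_of_nonneg_right (mul_nonneg (by linarith) h1)
    _ ≤ _ := by
        rw [Finset.mul_sum, Finset.mul_sum, ← Finset.sum_add_distrib]
        exact Finset.sum_le_sum fun e _ => add_mul_betaW_le (Γ.isLatency e) hx (hs e) _ _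

end CongestionGame

theorem classApproxPoA_le_gammaW (ε : ℝ≥0) (G : Set CongestionGame) :
    classApproxPoA ε G ≤ gammaW ε G := by
  refine iSup₂_le fun Γ hΓ => le_iInf₂ fun x hx => ?_
  set S : EReal := ⨆ (f : ℝ≥0 → ℝ≥0) (_ : f ∈ latencyClass G) (k : ℝ≥0) (_ : 0 < k) (o : ℝ≥0)
    (_ : 0 < o), ((gammaWTuple ε x k o f : ℝ) : EReal) with hS
  have hle (e : Γ.Resource) (k : ℝ≥0) (hk : 0 < k) (o : ℝ≥0) (ho : 0 < o) :
      ((gammaWTuple ε x k o (Γ.latency e) : ℝ) : EReal) ≤ S :=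
    le_iSup₂_of_le _ ⟨Γ, hΓ, e, rfl⟩ <| le_iSup₂_of_le k hk <|
      le_iSup₂ (f := fun o (_ : 0 < o) => ((gammaWTuple ε x k o (Γ.latency e) : ℝ) : EReal)) o ho
  refine iSup₂_le fun σ hσ => iSup₂_le fun τ hτ => ?_
  clear_value S
  induction S with
  | top => exact le_top
  | bot =>
    obtain ⟨i, -⟩ := Γ.exists_weight_pos
    obtain ⟨e, -⟩ := Γ.nonempty_of_mem i _ (hσ.1 i)
    exact absurd (hle e 1 one_pos 1 one_pos) (by simp)
  | coe s =>
    rw [EReal.coe_le_coe_iff, div_le_iff₀ (by exact_mod_cast hτ.1.socialCost_pos)]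
    exact hσ.socialCost_le_mul hτ.1 hx fun e k hk o ho =>
      EReal.coe_le_coe_iff.1 (hle e k hk o ho)

theorem classApproxPoA_mono (ε : ℝ≥0) {G H : Set CongestionGame} (h : G ⊆ H) :
    classApproxPoA ε G ≤ classApproxPoA ε H :=
  biSup_mono h

theorem CongestionGame.div_le_approxPoA {Γ : CongestionGame} {ε : ℝ≥0}
    {σ τ : Γ.Player → Finset Γ.Resource} (hσ : Γ.IsApproxNash ε σ) (hτ : Γ.IsProfile τ) :
    (((Γ.socialCost σ : ℝ) / (Γ.socialCost τ : ℝ) : ℝ) : EReal) ≤ Γ.approxPoA ε := by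
  obtain ⟨ρ, hρ, hmin⟩ := Set.exists_min_image {ρ | Γ.IsProfile ρ} Γ.socialCost
    (Set.toFinite _) ⟨τ, hτ⟩
  refine le_iSup₂_of_le σ hσ (le_iSup₂_of_le ρ ⟨hρ, hmin⟩ ?_)
  rw [EReal.coe_le_coe_iff]
  have h0 : (0 : ℝ) < Γ.socialCost ρ := by exact_mod_cast hρ.socialCost_pos
  have h1 : (Γ.socialCost ρ : ℝ) ≤ Γ.socialCost τ := by exact_mod_cast hmin τ hτ
  gcongr

/-! ### Load balancing games -/

namespace CongestionGame

variable (Γ : CongestionGame)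

/-- The profile in which each player `p` uses the single resource `s p`. -/
def singletonProfile (s : Γ.Player → Γ.Resource) : Γ.Player → Finset Γ.Resource := fun p => {s p}

/-- The congestion of `r` when each player `p` uses the single resource `s p`. -/
def load (s : Γ.Player → Γ.Resource) (r : Γ.Resource) : ℝ≥0 :=
  ∑ p ∈ Finset.univ.filter (fun p => s p = r), Γ.weight p

variable {Γ}

theorem congestion_singletonProfile (s : Γ.Player → Γ.Resource) (r : Γ.Resource) :
    Γ.congestion (Γ.singletonProfile s) r = Γ.load s r := by
  refine Finset.sum_congr (Finset.filter_congr fun p _ => ?_) fun _ _ => rfl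
  rw [singletonProfile, Finset.mem_singleton, eq_comm]

theorem cost_singletonProfile (s : Γ.Player → Γ.Resource) (p : Γ.Player) :
    Γ.cost (Γ.singletonProfile s) p = Γ.latency (s p) (Γ.load s (s p)) := by
  rw [← congestion_singletonProfile]
  exact Finset.sum_singleton _ _

theorem socialCost_singletonProfile (s : Γ.Player → Γ.Resource) :
    Γ.socialCost (Γ.singletonProfile s) =
      ∑ p, Γ.weight p * Γ.latency (s p) (Γ.load s (s p)) := by
  simp_rw [socialCost, cost_singletonProfile]

theorem update_singletonProfile (s : Γ.Player → Γ.Resource) (p : Γ.Player) (r : Γ.Resource) :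
    Function.update (Γ.singletonProfile s) p {r} =
      Γ.singletonProfile (Function.update s p r) := by
  ext1 q
  by_cases h : q = p
  · subst h; simp [singletonProfile]
  · simp [singletonProfile, Function.update_of_ne h]

theorem load_add_weight_le_load_update (s : Γ.Player → Γ.Resource) {p : Γ.Player} {r : Γ.Resource}
    (h : r ≠ s p) : Γ.load s r + Γ.weight p ≤ Γ.load (Function.update s p r) r := by
  have hsub : insert p (Finset.univ.filter fun q => s q = r) ⊆
      Finset.univ.filter fun q => Function.update s p r q = r := by
    intro q
    by_cases h : q = p
    · subst h; simp
    · simp [h]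
  refine le_trans ?_ (Finset.sum_le_sum_of_subset hsub)
  rw [Finset.sum_insert (by simpa using h.symm), add_comm, load]

theorem isApproxNash_singletonProfile {ε : ℝ≥0} {s : Γ.Player → Γ.Resource}
    (hs : Γ.IsProfile (Γ.singletonProfile s)) (hΓ : Γ.IsLoadBalancing)
    (hdev : ∀ p r, {r} ∈ Γ.strategies p → r ≠ s p →
      Γ.latency (s p) (Γ.load s (s p)) ≤ (1 + ε) * Γ.latency r (Γ.load s r + Γ.weight p)) :
    Γ.IsApproxNash ε (Γ.singletonProfile s) := by
  refine ⟨hs, fun p S hS => ?_⟩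
  obtain ⟨r, rfl⟩ := Finset.card_eq_one.1 (hΓ p S hS)
  rw [update_singletonProfile, cost_singletonProfile, cost_singletonProfile, Function.update_self]
  by_cases hr : r = s p
  · rw [hr, Function.update_eq_self]
    exact le_mul_of_one_le_left zero_le le_self_add
  · refine (hdev p r hS hr).trans ?_
    gcongr
    exact (Γ.isLatency r).mono (load_add_weight_le_load_update s hr)

end CongestionGame

/-! ### Tree games -/

/-- Resources of the tree game: the nodes of the complete `n`-ary tree of depth `L`, a node of
level `i` being a word of length `i`. -/
abbrev TreeResource (L n : ℕ) : Type := Σ i : Fin (L + 1), (Fin i → Fin n)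

/-- Players of the tree game: the edges of the tree. The edge from a node of level `i` to its child
`v` is encoded as `⟨i, v⟩`, and its parent node is `Fin.tail v`. -/
abbrev TreePlayer (L n : ℕ) : Type := Σ i : Fin L, (Fin (i + 1) → Fin n)

namespace TreePlayer

variable {L n : ℕ}

/-- The upper end of an edge: the resource the player uses in the equilibrium. -/
def parent (p : TreePlayer L n) : TreeResource L n := ⟨p.1.castSucc, Fin.tail p.2⟩

/-- The lower end of an edge: the resource the player uses in the cheap profile. -/
def child (p : TreePlayer L n) : TreeResource L n := ⟨p.1.succ, p.2⟩

theorem child_injective : Function.Injective (child : TreePlayer L n → TreeResource L n) := by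
  rintro ⟨i, v⟩ ⟨j, w⟩ h
  obtain ⟨h1, h2⟩ := Sigma.mk.inj h
  obtain rfl := Fin.succ_injective _ h1
  exact congrArg (Sigma.mk i) (eq_of_heq h2)

theorem sum_filter_parent_eq (w : ℕ → ℝ≥0) (p : TreePlayer L n) :
    ∑ q ∈ Finset.univ.filter (fun q : TreePlayer L n => q.parent = p.parent), w q.1 =
      n * w p.1 := by
  obtain ⟨i, v⟩ := p
  have : Finset.univ.filter (fun q : TreePlayer L n => q.parent = parent ⟨i, v⟩) =
      Finset.univ.image fun a : Fin n =>
        (⟨i, Fin.cons (α := fun _ => Fin n) a (Fin.tail v)⟩ : TreePlayer L n) := by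
    ext ⟨j, u⟩
    simp only [Finset.mem_filter, Finset.mem_univ, true_and, Finset.mem_image]
    constructor
    · intro h
      obtain ⟨h1, h2⟩ := Sigma.mk.inj h
      obtain rfl := Fin.castSucc_injective _ h1
      refine ⟨u 0, ?_⟩
      rw [← eq_of_heq h2, Fin.cons_self_tail]
    · rintro ⟨a, h⟩
      obtain ⟨rfl, h2⟩ := Sigma.mk.inj h
      rw [← eq_of_heq h2, parent, parent, Fin.tail_cons]
  rw [this, Finset.sum_image]
  · simp
  · intro a _ b _ h
    have := congrFun (eq_of_heq (Sigma.mk.inj h).2) 0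
    simpa using this

theorem sum_level (g : ℕ → ℝ≥0) :
    ∑ p : TreePlayer L n, g p.1 = ∑ i ∈ Finset.range L, (n : ℝ≥0) ^ (i + 1) * g i := by
  rw [Fintype.sum_sigma, ← Fin.sum_univ_eq_sum_range (fun i => (n : ℝ≥0) ^ (i + 1) * g i)]
  simp

end TreePlayer

/-- The load balancing game on a tree: latencies and weights depend on levels only, and `allowed p`
lists the resources open to the player `p`. -/
def treeGame (L n : ℕ) (hL : 2 ≤ L) (hn : 0 < n) (ℓ : ℕ → ℝ≥0 → ℝ≥0)
    (hℓ : ∀ i ≤ L, IsLatency (ℓ i)) (w : ℕ → ℝ≥0) (hw : 0 < w 0)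
    (allowed : TreePlayer L n → Set (TreeResource L n)) (hne : ∀ p, (allowed p).Nonempty) :
    CongestionGame where
  Player := TreePlayer L n
  Resource := TreeResource L n
  two_le_card := by
    have : Nontrivial (TreePlayer L n) :=
      ⟨⟨⟨0, by omega⟩, fun _ => ⟨0, hn⟩⟩, ⟨⟨1, by omega⟩, fun _ => ⟨0, hn⟩⟩, fun h => by
        simpa using congrArg Fin.val (Sigma.mk.inj h).1⟩
    exact Fintype.one_lt_card
  latency r := ℓ r.1
  isLatency r := hℓ r.1 (by omega)
  weight p := w p.1
  exists_weight_pos := ⟨⟨⟨0, by omega⟩, fun _ => ⟨0, hn⟩⟩, hw⟩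
  strategies p := (fun r => {r}) '' allowed p
  strategies_nonempty p := (hne p).image _
  nonempty_of_mem := by
    rintro p _ ⟨r, -, rfl⟩
    exact Finset.singleton_nonempty r

section treeGame

variable {L n : ℕ} {hL : 2 ≤ L} {hn : 0 < n} {ℓ : ℕ → ℝ≥0 → ℝ≥0}
    {hℓ : ∀ i ≤ L, IsLatency (ℓ i)} {w : ℕ → ℝ≥0} {hw : 0 < w 0}
    {allowed : TreePlayer L n → Set (TreeResource L n)} {hne : ∀ p, (allowed p).Nonempty}

theorem treeGame_isLoadBalancing :
    (treeGame L n hL hn ℓ hℓ w hw allowed hne).IsLoadBalancing := by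
  rintro p _ ⟨r, -, rfl⟩
  exact Finset.card_singleton r

theorem treeGame_load_parent (p : TreePlayer L n) :
    (treeGame L n hL hn ℓ hℓ w hw allowed hne).load TreePlayer.parent p.parent = n * w p.1 :=
  TreePlayer.sum_filter_parent_eq w p

theorem treeGame_load_child (p : TreePlayer L n) :
    (treeGame L n hL hn ℓ hℓ w hw allowed hne).load TreePlayer.child p.child = w p.1 := by
  have : Finset.univ.filter (fun q : TreePlayer L n => q.child = p.child) = {p} := by
    simp [TreePlayer.child_injective.eq_iff, Finset.filter_eq']
  exact (congrArg (fun s => ∑ q ∈ s, w q.1) this).trans (Finset.sum_singleton _ _)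

/-- The lower bound is an equality above the leaves, and the leaves, which nobody uses in the
equilibrium, are covered by `w L = 0`. -/
theorem mul_le_treeGame_load_parent (hwL : w L = 0) (r : TreeResource L n) :
    n * w r.1 ≤ (treeGame L n hL hn ℓ hℓ w hw allowed hne).load TreePlayer.parent r := by
  obtain ⟨i, u⟩ := r
  rcases Fin.eq_castSucc_or_eq_last i with ⟨i, rfl⟩ | rfl
  · exact (treeGame_load_parent
      (⟨i, Fin.cons (α := fun _ => Fin n) ⟨0, hn⟩ u⟩ : TreePlayer L n)).ge
  · simp [hwL]

theorem treeGame_socialCost_parent :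
    (treeGame L n hL hn ℓ hℓ w hw allowed hne).socialCost
        (CongestionGame.singletonProfile _ TreePlayer.parent) =
      ∑ i ∈ Finset.range L, (n : ℝ≥0) ^ (i + 1) * (w i * ℓ i (n * w i)) := by
  rw [← TreePlayer.sum_level (n := n) (fun i => w i * ℓ i (n * w i))]
  refine (CongestionGame.socialCost_singletonProfile _).trans (Finset.sum_congr rfl fun p _ => ?_)
  exact congrArg (fun y => w p.1 * ℓ p.1 y) (treeGame_load_parent p)

theorem treeGame_socialCost_child :
    (treeGame L n hL hn ℓ hℓ w hw allowed hne).socialCost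
        (CongestionGame.singletonProfile _ TreePlayer.child) =
      ∑ i ∈ Finset.range L, (n : ℝ≥0) ^ (i + 1) * (w i * ℓ (i + 1) (w i)) := by
  rw [← TreePlayer.sum_level (n := n) (fun i => w i * ℓ (i + 1) (w i))]
  refine (CongestionGame.socialCost_singletonProfile _).trans (Finset.sum_congr rfl fun p _ => ?_)
  exact congrArg (fun y => w p.1 * ℓ (p.1 + 1) y) (treeGame_load_child p)

theorem treeGame_isApproxNash_parent {ε : ℝ≥0} (hparent : ∀ p, TreePlayer.parent p ∈ allowed p)
    (hwL : w L = 0)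
    (hdev : ∀ p : TreePlayer L n, ∀ r ∈ allowed p,
      ℓ p.1 (n * w p.1) ≤ (1 + ε) * ℓ r.1 (n * w r.1 + w p.1)) :
    (treeGame L n hL hn ℓ hℓ w hw allowed hne).IsApproxNash ε
      (CongestionGame.singletonProfile _ TreePlayer.parent) := by
  refine CongestionGame.isApproxNash_singletonProfile (fun p => ⟨_, hparent p, rfl⟩)
    treeGame_isLoadBalancing ?_
  rintro p r ⟨r', hr', h⟩ -
  obtain rfl := Finset.singleton_injective h
  refine (le_of_eq (congrArg (ℓ p.1) (treeGame_load_parent p))).trans ((hdev p r' hr').trans ?_)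
  refine mul_le_mul_of_nonneg_left ((hℓ r'.1 (by omega)).mono ?_) zero_le
  exact add_le_add_left (mul_le_treeGame_load_parent hwL r') _

end treeGame

/-! ### Selecting two tuples -/

/-- A one-dimensional duality: if at every `x ≥ 1` some line `x ↦ a t + x * b t` exceeds `M`, then
at a single `x` both a non-decreasing line `s` and a non-increasing line `t` exceed `M`, except that
`t` may be arbitrary if `x = 1`. The point `x` lies just right of the infimum of all points where
some non-decreasing line exceeds `M`. -/
theorem exists_multiplier {T : Type*} (a b : T → ℝ) {M : ℝ}
    (h : ∀ x ≥ 1, ∃ t, M < a t + x * b t) (hpos : ∃ t, 0 < b t) :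
    ∃ x ≥ 1, ∃ s t, (0 ≤ b s ∧ M < a s + x * b s) ∧ (x = 1 ∨ b t ≤ 0) ∧ M < a t + x * b t := by
  set S : Set ℝ := {x | 1 ≤ x ∧ ∃ s, 0 ≤ b s ∧ M < a s + x * b s} with hS
  by_cases h1 : (1 : ℝ) ∈ S
  · obtain ⟨-, s, hs⟩ := h1
    exact ⟨1, le_rfl, s, s, hs, Or.inl rfl, hs.2⟩
  have hne : S.Nonempty := by
    obtain ⟨t, ht⟩ := hpos
    refine ⟨max 1 ((M - a t + 1) / b t), le_max_left _ _, t, ht.le, ?_⟩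
    have := mul_le_mul_of_nonneg_right (le_max_right 1 ((M - a t + 1) / b t)) ht.le
    rw [div_mul_cancel₀ _ ht.ne'] at this
    linarith
  have hbdd : BddBelow S := ⟨1, fun x hx => hx.1⟩
  have hx0 : 1 ≤ sInf S := le_csInf hne fun x hx => hx.1
  -- A strict inequality at a point of `S` other than `1` persists slightly to its left.
  have hnot : sInf S ∉ S := by
    rintro ⟨-, s, hs, hlt⟩
    have hgt : 1 < sInf S := lt_of_le_of_ne hx0 fun he => h1 (by
      rw [← he] at hlt
      exact ⟨le_rfl, s, hs, hlt⟩)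
    have hev : ∀ᶠ x in nhds (sInf S), 1 < x ∧ M < a s + x * b s :=
      (lt_mem_nhds hgt).and
        ((Continuous.tendsto (f := fun x => a s + x * b s) (by fun_prop) _).eventually_const_lt hlt)
    obtain ⟨y, hy, hyl⟩ := ((hev.filter_mono nhdsWithin_le_nhds).and
      (self_mem_nhdsWithin (s := Set.Iio (sInf S)))).exists
    exact absurd (csInf_le hbdd ⟨hy.1.le, s, hs, hy.2⟩) (not_le.2 hyl)
  obtain ⟨t, ht⟩ := h _ hx0
  have hbt : b t < 0 := by
    by_contra hb
    exact hnot ⟨hx0, t, not_lt.1 hb, ht⟩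
  obtain ⟨η, hη, hηM⟩ := Metric.eventually_nhds_iff.1
    ((Continuous.tendsto (f := fun x => a t + x * b t) (by fun_prop) _).eventually_const_lt ht)
  obtain ⟨x, ⟨hx1, s, hs, hxs⟩, hxlt⟩ := exists_lt_of_csInf_lt hne (lt_add_of_pos_right (sInf S) hη)
  refine ⟨x, hx1, s, t, ⟨hs, hxs⟩, Or.inr hbt.le, hηM ?_⟩
  have := csInf_le hbdd ⟨hx1, s, hs, hxs⟩
  rw [Real.dist_eq, abs_lt]
  constructor <;> linarith

/-- Telescoping: if `P` is non-decreasing along the first `m` steps and non-increasing along the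
next `m'` ones, the slack `δ` in the steps pays for both ends once `m` and `m'` are large. -/
theorem mul_sum_le_sum_of_steps {P Q : ℕ → ℝ} {M x δ : ℝ} {m m' : ℕ} (hP : ∀ i, 0 ≤ P i)
    (hx : 1 ≤ x) (hδ : 0 ≤ δ)
    (hstep : ∀ i < m + m', M * Q i + δ * P i ≤ P (i + 1) + x * (P i - P (i + 1)))
    (hlast : M * Q (m + m') ≤ |M| * P (m + m'))
    (hup : ∀ i < m, P i ≤ P (i + 1)) (hdown : ∀ i, m ≤ i → i < m + m' → P (i + 1) ≤ P i)
    (hm : x - 1 ≤ δ * m) (hm' : |M| ≤ δ * m') :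
    M * ∑ i ∈ Finset.range (m + m' + 1), Q i ≤ ∑ i ∈ Finset.range (m + m' + 1), P i := by
  have hup' : ∀ i ≤ m, P 0 ≤ P i := by
    intro i
    induction i with
    | zero => intro; exact le_rfl
    | succ i ih => exact fun h => (ih (by omega)).trans (hup i (by omega))
  have hdown' : ∀ j ≤ m', P (m + m') ≤ P (m + m' - j) := by
    intro j
    induction j with
    | zero => intro; exact le_rfl
    | succ j ih =>
      intro h
      refine (ih (by omega)).trans ?_
      have := hdown (m + m' - (j + 1)) (by omega) (by omega)
      rwa [show m + m' - (j + 1) + 1 = m + m' - j by omega] at this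
  have h1 : m * P 0 + m' * P (m + m') ≤ ∑ i ∈ Finset.range (m + m'), P i := by
    rw [Finset.sum_range_add]
    refine add_le_add ?_ ?_
    · have := Finset.card_nsmul_le_sum (Finset.range m) P (P 0)
        fun i hi => hup' i (Finset.mem_range.1 hi).le
      simpa using this
    · have := Finset.card_nsmul_le_sum (Finset.range m') (fun i => P (m + i)) (P (m + m'))
        fun i hi => by
          have hi := Finset.mem_range.1 hi
          have := hdown' (m' - i) (by omega)
          rwa [show m + m' - (m' - i) = m + i by omega] at this
      simpa using this
  have h2 := Finset.sum_le_sum fun i hi => hstep i (Finset.mem_range.1 hi)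
  rw [Finset.sum_add_distrib, Finset.sum_add_distrib, ← Finset.mul_sum, ← Finset.mul_sum,
    ← Finset.mul_sum, Finset.sum_range_sub'] at h2
  have h3 : ∑ i ∈ Finset.range (m + m' + 1), P i = ∑ i ∈ Finset.range (m + m'), P (i + 1) + P 0 :=
    Finset.sum_range_succ' _ _
  rw [h3, Finset.sum_range_succ, mul_add]
  have h4 := mul_le_mul_of_nonneg_left h1 hδ
  have h5 := mul_le_mul_of_nonneg_right hm (hP 0)
  have h6 := mul_le_mul_of_nonneg_right hm' (hP (m + m'))
  have h7 : 0 ≤ x * P (m + m') := mul_nonneg (by linarith) (hP _)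
  linarith

theorem exists_gammaWTuple_gt {C : Set (ℝ≥0 → ℝ≥0)} {ε : ℝ≥0} {M : ℝ}
    (hM : (M : EReal) < gammaW ε (weightedGames C)) {x : ℝ} (hx : 1 ≤ x) :
    ∃ f ∈ C, ∃ k > 0, ∃ o > 0, M < gammaWTuple ε x k o f := by
  have h := hM.trans_le (iInf₂_le x hx)
  simp only [lt_iSup_iff, EReal.coe_lt_coe_iff] at h
  obtain ⟨f, ⟨Γ, hΓ, e, rfl⟩, k, hk, o, ho, h⟩ := h
  exact ⟨_, hΓ e, k, hk, o, ho, h⟩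

/-- Constant functions can be dropped: they only give values below `x * (1 + ε)`, which any latency
function approaches as `k / o` tends to `0`. -/
theorem exists_nonconstant_gammaWTuple_gt {C : Set (ℝ≥0 → ℝ≥0)} (hlat : ∀ f ∈ C, IsLatency f)
    (hnonconst : ∃ f ∈ C, ¬ IsConstantLatency f) {ε : ℝ≥0}
    {M : ℝ} (hM : (M : EReal) < gammaW ε (weightedGames C)) {x : ℝ} (hx : 1 ≤ x) :
    ∃ f ∈ C, ¬ IsConstantLatency f ∧ ∃ k > 0, ∃ o > 0, M < gammaWTuple ε x k o f := by
  obtain ⟨f, hf, k, hk, o, ho, h⟩ := exists_gammaWTuple_gt hM hx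
  by_cases hc : IsConstantLatency f
  swap
  · exact ⟨f, hf, hc, k, hk, o, ho, h⟩
  obtain ⟨c, hc⟩ := hc
  obtain ⟨g, hg, hgc⟩ := hnonconst
  have hM' : M < x * (1 + ε) - (x - 1) * ((0 : ℝ≥0) : ℝ) := by
    have hfo := hc o ▸ (hlat f hf).pos o ho
    have hcpos : (0 : ℝ) < c := by exact_mod_cast hfo
    have ho' : (0 : ℝ) < o := by exact_mod_cast ho
    refine h.trans_le ?_
    rw [gammaWTuple, betaW, div_le_iff₀ (by rw [hc]; positivity)]
    simp only [hc, NNReal.coe_zero, mul_zero, sub_zero]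
    have : 0 ≤ (x - 1) * (k * c) := mul_nonneg (by linarith) (by positivity)
    linarith
  have hev := ((Continuous.tendsto
    (f := fun t : ℝ≥0 => x * (1 + ε) - (x - 1) * (t : ℝ)) (by fun_prop) 0).eventually_const_lt
      hM').and (Iic_mem_nhds (zero_lt_one (α := ℝ≥0)))
  obtain ⟨t, ⟨ht, ht1⟩, ht0⟩ := ((hev.filter_mono nhdsWithin_le_nhds).and
    (self_mem_nhdsWithin (s := Set.Ioi (0 : ℝ≥0)))).exists
  refine ⟨g, hg, hgc, 1 * t, by simpa using ht0, 1, one_pos, ht.trans_le ?_⟩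
  exact sub_le_gammaWTuple (hlat g hg) ε hx one_pos ht1

/-! ### Level data -/

/-- Data for a tree game of depth `L`: the resources of level `i` get a rescaled copy of `f i`, so
that in terms of `f i` the equilibrium users form a congestion `k i` and the single user in the
cheap profile a congestion `o i`. Nobody uses the leaves in the equilibrium, hence `k L = 0`. -/
structure IsLevelData (C : Set (ℝ≥0 → ℝ≥0)) (L : ℕ) (f : ℕ → ℝ≥0 → ℝ≥0) (k o : ℕ → ℝ≥0) :
    Prop where
  mem : ∀ i, f i ∈ C
  o_pos : ∀ i, 0 < o i
  k_pos : ∀ i < L, 0 < k i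
  k_last : k L = 0

/-- The weight of the players of level `i`. -/
noncomputable def levelWeight (n : ℕ) (k o : ℕ → ℝ≥0) : ℕ → ℝ≥0
  | 0 => k 0 / n
  | i + 1 => levelWeight n k o i * k (i + 1) / (n * o (i + 1))

/-- The abscissa scaling of level `i`: it turns the weight of a player of level `i - 1` into the
congestion `o i`. -/
noncomputable def levelDilation (n : ℕ) (k o : ℕ → ℝ≥0) : ℕ → ℝ≥0
  | 0 => 1
  | i + 1 => o (i + 1) / levelWeight n k o i

/-- The equilibrium cost of the players of level `i`. -/
noncomputable def levelCost (ε : ℝ≥0) (f : ℕ → ℝ≥0 → ℝ≥0) (k o : ℕ → ℝ≥0) : ℕ → ℝ≥0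
  | 0 => f 0 (k 0)
  | i + 1 => levelCost ε f k o i * f (i + 1) (k (i + 1)) /
      ((1 + ε) * f (i + 1) (k (i + 1) + o (i + 1)))

/-- The ordinate scaling of level `i`: it makes the equilibrium condition of a player of level
`i - 1` towards the level `i` an equality. -/
noncomputable def levelFactor (ε : ℝ≥0) (f : ℕ → ℝ≥0 → ℝ≥0) (k o : ℕ → ℝ≥0) : ℕ → ℝ≥0
  | 0 => 1
  | i + 1 => levelCost ε f k o i / ((1 + ε) * f (i + 1) (k (i + 1) + o (i + 1)))

/-- The latency of the resources of level `i`. -/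
noncomputable def levelLatency (ε : ℝ≥0) (n : ℕ) (f : ℕ → ℝ≥0 → ℝ≥0) (k o : ℕ → ℝ≥0) (i : ℕ) :
    ℝ≥0 → ℝ≥0 :=
  fun y => levelFactor ε f k o i * f i (levelDilation n k o i * y)

theorem levelFactor_mul (ε : ℝ≥0) (f : ℕ → ℝ≥0 → ℝ≥0) (k o : ℕ → ℝ≥0) (i : ℕ) :
    levelFactor ε f k o i * f i (k i) = levelCost ε f k o i := by
  cases i with
  | zero => exact one_mul _
  | succ i => rw [levelFactor, levelCost, div_mul_eq_mul_div]

namespace IsLevelData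

variable {C : Set (ℝ≥0 → ℝ≥0)} {L n : ℕ} {ε : ℝ≥0} {f : ℕ → ℝ≥0 → ℝ≥0} {k o : ℕ → ℝ≥0}

theorem weight_pos (h : IsLevelData C L f k o) (hn : 0 < n) :
    ∀ i < L, 0 < levelWeight n k o i := by
  have hn' : (0 : ℝ≥0) < n := by exact_mod_cast hn
  intro i
  induction i with
  | zero => exact fun hi => div_pos (h.k_pos 0 hi) hn'
  | succ i ih =>
    exact fun hi => div_pos (mul_pos (ih (by omega)) (h.k_pos _ hi)) (mul_pos hn' (h.o_pos _))

theorem weight_last (h : IsLevelData C L f k o) (hL : L ≠ 0) : levelWeight n k o L = 0 := by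
  obtain ⟨l, rfl⟩ := Nat.exists_eq_succ_of_ne_zero hL
  rw [levelWeight, h.k_last, mul_zero, zero_div]

theorem dilation_pos (h : IsLevelData C L f k o) (hn : 0 < n) :
    ∀ i ≤ L, 0 < levelDilation n k o i
  | 0, _ => one_pos
  | i + 1, hi => div_pos (h.o_pos _) (h.weight_pos hn i (by omega))

theorem dilation_mul_weight (h : IsLevelData C L f k o) (hn : 0 < n) {i : ℕ} (hi : i < L) :
    levelDilation n k o (i + 1) * levelWeight n k o i = o (i + 1) :=
  div_mul_cancel₀ _ (h.weight_pos hn i hi).ne'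

theorem dilation_mul_load (h : IsLevelData C L f k o) (hn : 0 < n) {i : ℕ} (hi : i ≤ L) :
    levelDilation n k o i * (n * levelWeight n k o i) = k i := by
  have hn' : (n : ℝ≥0) ≠ 0 := by exact_mod_cast hn.ne'
  cases i with
  | zero => rw [levelDilation, levelWeight, one_mul, mul_div_cancel₀ _ hn']
  | succ i =>
    have h1 := (h.o_pos (i + 1)).ne'
    have h2 := (h.weight_pos hn i (by omega)).ne'
    rw [levelDilation, levelWeight]
    field_simp

theorem latency_load_add (h : IsLevelData C L f k o) (hn : 0 < n) {i : ℕ} (hi : i ≤ L) (y : ℝ≥0) :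
    levelLatency ε n f k o i (n * levelWeight n k o i + y) =
      levelFactor ε f k o i * f i (k i + levelDilation n k o i * y) := by
  rw [levelLatency, mul_add, h.dilation_mul_load hn hi]

theorem latency_load (h : IsLevelData C L f k o) (hn : 0 < n) {i : ℕ} (hi : i ≤ L) :
    levelLatency ε n f k o i (n * levelWeight n k o i) = levelCost ε f k o i := by
  have := h.latency_load_add (ε := ε) hn hi 0
  rwa [add_zero, mul_zero, add_zero, levelFactor_mul] at this

theorem latency_weight (h : IsLevelData C L f k o) (hn : 0 < n) {i : ℕ} (hi : i < L) :
    levelLatency ε n f k o (i + 1) (levelWeight n k o i) =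
      levelFactor ε f k o (i + 1) * f (i + 1) (o (i + 1)) := by
  rw [levelLatency, h.dilation_mul_weight hn hi]

theorem denom_pos (h : IsLevelData C L f k o) (hlat : ∀ f ∈ C, IsLatency f) (i : ℕ) :
    0 < (1 + ε) * f i (k i + o i) :=
  mul_pos (by positivity) ((hlat _ (h.mem i)).pos _ (lt_of_lt_of_le (h.o_pos i) le_add_self))

theorem cost_pos (h : IsLevelData C L f k o) (hlat : ∀ f ∈ C, IsLatency f) :
    ∀ i < L, 0 < levelCost ε f k o i := by
  intro i
  induction i with
  | zero => exact fun hi => (hlat _ (h.mem 0)).pos _ (h.k_pos 0 hi)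
  | succ i ih =>
    exact fun hi => div_pos (mul_pos (ih (by omega))
      ((hlat _ (h.mem _)).pos _ (h.k_pos _ hi))) (h.denom_pos hlat _)

theorem factor_pos (h : IsLevelData C L f k o) (hlat : ∀ f ∈ C, IsLatency f) :
    ∀ i ≤ L, 0 < levelFactor ε f k o i
  | 0, _ => one_pos
  | i + 1, hi => div_pos (h.cost_pos hlat i (by omega)) (h.denom_pos hlat _)

/-- Costs decrease down the tree, as `f (k i) ≤ (1 + ε) f (k i + o i)`. -/
theorem cost_antitone (h : IsLevelData C L f k o) (hlat : ∀ f ∈ C, IsLatency f) :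
    Antitone (levelCost ε f k o) := by
  refine antitone_nat_of_succ_le fun i => ?_
  rw [levelCost]
  refine div_le_of_le_mul₀ zero_le zero_le ?_
  gcongr
  refine le_trans ?_ (le_mul_of_one_le_left zero_le le_self_add)
  exact (hlat _ (h.mem _)).mono le_self_add

/-- The equilibrium condition of a player towards the next level, which holds with equality. -/
theorem cost_eq_deviation (h : IsLevelData C L f k o) (hlat : ∀ f ∈ C, IsLatency f)
    (hn : 0 < n) {i : ℕ} (hi : i < L) :
    levelCost ε f k o i = (1 + ε) *
      levelLatency ε n f k o (i + 1) (n * levelWeight n k o (i + 1) + levelWeight n k o i) := by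
  rw [h.latency_load_add hn hi, h.dilation_mul_weight hn hi, levelFactor, mul_left_comm,
    div_mul_cancel₀ _ (h.denom_pos hlat _).ne']

/-- No player gains by moving within her level or up the tree: the users there already pay at least
as much as she does. -/
theorem cost_le_deviation_of_le (h : IsLevelData C L f k o) (hlat : ∀ f ∈ C, IsLatency f)
    (hn : 0 < n) {i j : ℕ} (hj : j ≤ L) (hij : j ≤ i) (y : ℝ≥0) :
    levelCost ε f k o i ≤ (1 + ε) *
      levelLatency ε n f k o j (n * levelWeight n k o j + y) := by
  refine (h.cost_antitone hlat hij).trans ?_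
  rw [h.latency_load_add hn hj, ← levelFactor_mul]
  refine le_trans ?_ (le_mul_of_one_le_left zero_le le_self_add)
  gcongr
  exact (hlat _ (h.mem _)).mono le_self_add

end IsLevelData

/-- Weights shrink by a factor of at least `R` per level once `n` is large. -/
theorem mul_levelWeight_le {L n : ℕ} {k o : ℕ → ℝ≥0} (hn : 0 < n) {R : ℝ≥0} (hR : 1 ≤ R)
    (hnR : ∀ i ≤ L, R * k i ≤ n * o i) {i j : ℕ} (hij : i < j) (hj : j ≤ L) :
    R * levelWeight n k o j ≤ levelWeight n k o i := by
  have hstep : ∀ i < L, R * levelWeight n k o (i + 1) ≤ levelWeight n k o i := by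
    intro i hi
    have hn' : (0 : ℝ≥0) < n := by exact_mod_cast hn
    rw [levelWeight, mul_div_assoc, mul_left_comm, ← mul_div_assoc]
    exact mul_le_of_le_one_right' (div_le_one_of_le₀ (hnR _ hi) zero_le)
  induction j, hij using Nat.le_induction with
  | base => exact hstep i (by omega)
  | succ j hij ih =>
    exact ((hstep j (by omega)).trans (le_mul_of_one_le_left zero_le hR)).trans (ih (by omega))

namespace IsLevelData

variable {C : Set (ℝ≥0 → ℝ≥0)} {L n : ℕ} {ε : ℝ≥0} {f : ℕ → ℝ≥0 → ℝ≥0} {k o : ℕ → ℝ≥0}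

/-- With unbounded latencies and large `n`, weights shrink so fast along the levels that no player
gains by moving two or more levels down. -/
theorem exists_cost_le_deviation (h : IsLevelData C L f k o) (hlat : ∀ f ∈ C, IsLatency f)
    (hunb : ∀ f ∈ C, IsUnboundedLatency f) (ε : ℝ≥0) :
    ∃ n > 0, ∀ i < L, ∀ j ≤ L, levelCost ε f k o i ≤
      (1 + ε) * levelLatency ε n f k o j (n * levelWeight n k o j + levelWeight n k o i) := by
  have hR : ∀ᶠ R : ℝ≥0 in Filter.atTop, ∀ i ∈ Finset.range (L + 1),
      levelCost ε f k o 0 ≤ levelFactor ε f k o i * f i (R * o i) := by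
    rw [Filter.eventually_all_finset]
    intro i hi
    refine Filter.Tendsto.eventually_ge_atTop (Filter.Tendsto.const_mul_atTop
      (h.factor_pos hlat i (Finset.mem_range_succ_iff.1 hi)) ?_) _
    exact (hunb _ (h.mem i)).comp (Filter.tendsto_id.atTop_mul_const (h.o_pos i))
  obtain ⟨R, hR, hR1⟩ := (hR.and (Filter.eventually_ge_atTop 1)).exists
  have hn : ∀ᶠ n : ℕ in Filter.atTop, ∀ i ∈ Finset.range (L + 1), R * k i ≤ n * o i := by
    rw [Filter.eventually_all_finset]
    exact fun i _ => (tendsto_natCast_atTop_atTop.atTop_mul_const (h.o_pos i)).eventually_ge_atTop _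
  obtain ⟨n, hnR, hn⟩ := (hn.and (Filter.eventually_gt_atTop 0)).exists
  simp only [Finset.mem_range_succ_iff] at hR hnR
  refine ⟨n, hn, fun i hi j hj => ?_⟩
  rcases lt_or_ge i j with hij | hij
  swap
  · exact h.cost_le_deviation_of_le hlat hn hj hij _
  obtain ⟨j, rfl⟩ := Nat.exists_eq_succ_of_ne_zero (by omega : j ≠ 0)
  rcases eq_or_lt_of_le (Nat.lt_succ_iff.1 hij) with rfl | hij
  · exact (h.cost_eq_deviation hlat hn hi).le
  refine (h.cost_antitone hlat (Nat.zero_le i)).trans ((hR _ hj).trans ?_)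
  rw [h.latency_load_add hn hj]
  refine le_trans ?_ (le_mul_of_one_le_left zero_le le_self_add)
  gcongr
  refine (hlat _ (h.mem _)).mono (le_trans ?_ le_add_self)
  rw [← h.dilation_mul_weight hn hj, mul_left_comm]
  gcongr
  exact mul_levelWeight_le hn hR1 hnR hij (by omega)

theorem latency_mem (h : IsLevelData C L f k o) (hlat : ∀ f ∈ C, IsLatency f)
    {D : Set (ℝ≥0 → ℝ≥0)} (hCD : C ⊆ D)
    (hord : ClosedUnderOrdinateScaling D) (habs : ClosedUnderAbscissaScaling D)
    (hn : 0 < n) {i : ℕ} (hi : i ≤ L) : levelLatency ε n f k o i ∈ D :=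
  hord _ (habs _ (hCD (h.mem i)) _ (h.dilation_pos hn i hi)) _ (h.factor_pos hlat i hi)

end IsLevelData

/-! ### Social costs per level -/

/-- The total weighted equilibrium cost of the players of level `i`. -/
noncomputable def levelNashCost (ε : ℝ≥0) (n : ℕ) (f : ℕ → ℝ≥0 → ℝ≥0) (k o : ℕ → ℝ≥0) (i : ℕ) :
    ℝ≥0 :=
  n ^ (i + 1) * (levelWeight n k o i * levelCost ε f k o i)

/-- The total weighted cost of the players of level `i` in the cheap profile. -/
noncomputable def levelChildCost (ε : ℝ≥0) (n : ℕ) (f : ℕ → ℝ≥0 → ℝ≥0) (k o : ℕ → ℝ≥0) (i : ℕ) :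
    ℝ≥0 :=
  n ^ (i + 1) * (levelWeight n k o i * (levelFactor ε f k o (i + 1) * f (i + 1) (o (i + 1))))

namespace IsLevelData

variable {C : Set (ℝ≥0 → ℝ≥0)} {L n : ℕ} {ε : ℝ≥0} {f : ℕ → ℝ≥0 → ℝ≥0} {k o : ℕ → ℝ≥0}

theorem nashCost_succ (h : IsLevelData C L f k o) (hlat : ∀ f ∈ C, IsLatency f) (hn : 0 < n)
    (i : ℕ) :
    levelNashCost ε n f k o (i + 1) *
        (o (i + 1) * ((1 + ε) * f (i + 1) (k (i + 1) + o (i + 1)))) =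
      levelNashCost ε n f k o i * (k (i + 1) * f (i + 1) (k (i + 1))) := by
  have hn' : (n : ℝ≥0) ≠ 0 := by exact_mod_cast hn.ne'
  have h1 := (h.o_pos (i + 1)).ne'
  have h2 := (h.denom_pos (ε := ε) hlat (i + 1)).ne'
  rw [levelNashCost, levelNashCost, levelWeight, levelCost]
  set d := (1 + ε) * f (i + 1) (k (i + 1) + o (i + 1))
  field_simp
  ring

theorem childCost_mul (h : IsLevelData C L f k o) (hlat : ∀ f ∈ C, IsLatency f) (i : ℕ) :
    levelChildCost ε n f k o i * ((1 + ε) * f (i + 1) (k (i + 1) + o (i + 1))) =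
      levelNashCost ε n f k o i * f (i + 1) (o (i + 1)) := by
  have h2 := (h.denom_pos (ε := ε) hlat (i + 1)).ne'
  rw [levelNashCost, levelChildCost, levelFactor]
  set d := (1 + ε) * f (i + 1) (k (i + 1) + o (i + 1))
  field_simp

/-- The tree game attains every ratio that the level costs certify, as soon as no player gains by
moving to a resource open to her. -/
theorem le_approxPoA (h : IsLevelData C L f k o) (hlat : ∀ f ∈ C, IsLatency f) (hL : 2 ≤ L)
    (hn : 0 < n) {M : ℝ}
    (hM : M * ∑ i ∈ Finset.range L, (levelChildCost ε n f k o i : ℝ) ≤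
      ∑ i ∈ Finset.range L, (levelNashCost ε n f k o i : ℝ))
    {D : Set (ℝ≥0 → ℝ≥0)} (hCD : C ⊆ D) (hlatD : ∀ f ∈ D, IsLatency f)
    (hord : ClosedUnderOrdinateScaling D) (habs : ClosedUnderAbscissaScaling D)
    (allowed : TreePlayer L n → Set (TreeResource L n))
    (hparent : ∀ p, TreePlayer.parent p ∈ allowed p) (hchild : ∀ p, TreePlayer.child p ∈ allowed p)
    (hdev : ∀ p : TreePlayer L n, ∀ r ∈ allowed p, levelCost ε f k o p.1 ≤ (1 + ε) *
      levelLatency ε n f k o r.1 (n * levelWeight n k o r.1 + levelWeight n k o p.1)) :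
    ∃ Γ ∈ weightedLoadBalancingGames D, ((∀ p, allowed p = Set.univ) → Γ.IsSymmetric) ∧
      (M : EReal) ≤ Γ.approxPoA ε := by
  have hmem : ∀ i ≤ L, levelLatency ε n f k o i ∈ D :=
    fun i hi => h.latency_mem hlat hCD hord habs hn hi
  have hne : ∀ p, (allowed p).Nonempty := fun p => ⟨_, hparent p⟩
  refine ⟨treeGame L n hL hn (levelLatency ε n f k o) (fun i hi => hlatD _ (hmem i hi))
    (levelWeight n k o) (h.weight_pos hn 0 (by omega)) allowed hne,
    ⟨fun r => hmem _ (Nat.lt_succ_iff.1 r.1.2), treeGame_isLoadBalancing⟩, ?_, ?_⟩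
  · intro hall p q
    exact congrArg (fun s => (fun r => ({r} : Finset (TreeResource L n))) '' s)
      ((hall p).trans (hall q).symm)
  have hchildProfile : CongestionGame.IsProfile _ (CongestionGame.singletonProfile
      (treeGame L n hL hn (levelLatency ε n f k o) (fun i hi => hlatD _ (hmem i hi))
      (levelWeight n k o) (h.weight_pos hn 0 (by omega)) allowed hne)
      TreePlayer.child) := fun p => ⟨_, hchild p, rfl⟩
  refine le_trans ?_ (CongestionGame.div_le_approxPoA
    (treeGame_isApproxNash_parent hparent (h.weight_last (by omega)) fun p r hr => ?_)
    hchildProfile)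
  · rw [EReal.coe_le_coe_iff, le_div_iff₀ (by exact_mod_cast hchildProfile.socialCost_pos),
      treeGame_socialCost_parent, treeGame_socialCost_child,
      Finset.sum_congr rfl fun i hi => by rw [h.latency_weight hn (Finset.mem_range.1 hi)],
      Finset.sum_congr (s₁ := Finset.range L) (f := fun i => _ * (_ * levelLatency ε n f k o i _))
        rfl fun i hi => by rw [h.latency_load hn (Finset.mem_range.1 hi).le]]
    rw [← NNReal.coe_sum, ← NNReal.coe_sum] at hM
    exact hM
  · rw [h.latency_load hn p.1.2.le]
    exact hdev p r hr

end IsLevelData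

/-! ### Choosing the levels -/

/-- One level of the tree, in real numbers: `P`, `P'` are the equilibrium costs of consecutive
levels and `Q` is the cheap cost of the first of them. -/
theorem exists_step_slack {f : ℝ≥0 → ℝ≥0} (hf : IsLatency f) {ε k o : ℝ≥0} (ho : 0 < o) {M x : ℝ}
    (hM : M < gammaWTuple ε x k o f) :
    ∃ δ > 0, ∀ P P' Q : ℝ, P' * (o * ((1 + ε) * f (k + o))) = P * (k * f k) →
      Q * ((1 + ε) * f (k + o)) = P * f o → M * Q + δ * P ≤ P' + x * (P - P') := by
  have hfo : (0 : ℝ) < f o := by exact_mod_cast hf.pos o ho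
  have ho' : (0 : ℝ) < o := by exact_mod_cast ho
  have hfk : (0 : ℝ) < f (k + o) := by exact_mod_cast hf.pos _ (lt_of_lt_of_le ho le_add_self)
  have hD : 0 < (o : ℝ) * ((1 + ε) * f (k + o)) := by positivity
  refine ⟨(gammaWTuple ε x k o f - M) * (o * f o) / (o * ((1 + ε) * f (k + o))),
    div_pos (mul_pos (sub_pos.2 hM) (by positivity)) hD, fun P P' Q h1 h2 => le_of_eq ?_⟩
  have h3 : gammaWTuple ε x k o f * (o * f o) = k * f k + x * betaW ε k o f :=
    div_mul_cancel₀ _ (by positivity)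
  rw [sub_mul, h3, betaW]
  refine mul_right_cancel₀ hD.ne' ?_
  have h4 : ∀ y : ℝ, y / (o * ((1 + ε) * f (k + o))) * P * (o * ((1 + ε) * f (k + o))) = y * P := by
    intro y
    field_simp
  rw [add_mul, h4]
  linear_combination (M * o) * h2 - (1 - x) * h1

theorem le_of_betaW_nonpos {f : ℝ≥0 → ℝ≥0} (hf : IsLatency f) {ε k o : ℝ≥0} (ho : 0 < o)
    (hβ : betaW ε k o f ≤ 0) {P P' : ℝ} (hP : 0 ≤ P)
    (h : P' * (o * ((1 + ε) * f (k + o))) = P * (k * f k)) : P ≤ P' := by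
  have ho' : (0 : ℝ) < o := by exact_mod_cast ho
  have hfk : (0 : ℝ) < f (k + o) := by exact_mod_cast hf.pos _ (lt_of_lt_of_le ho le_add_self)
  have hD : 0 < (o : ℝ) * ((1 + ε) * f (k + o)) := by positivity
  refine le_of_mul_le_mul_right ?_ hD
  rw [h, betaW] at *
  exact mul_le_mul_of_nonneg_left (by linarith) hP

theorem le_of_betaW_nonneg {f : ℝ≥0 → ℝ≥0} (hf : IsLatency f) {ε k o : ℝ≥0} (ho : 0 < o)
    (hβ : 0 ≤ betaW ε k o f) {P P' : ℝ} (hP : 0 ≤ P)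
    (h : P' * (o * ((1 + ε) * f (k + o))) = P * (k * f k)) : P' ≤ P := by
  have ho' : (0 : ℝ) < o := by exact_mod_cast ho
  have hfk : (0 : ℝ) < f (k + o) := by exact_mod_cast hf.pos _ (lt_of_lt_of_le ho le_add_self)
  have hD : 0 < (o : ℝ) * ((1 + ε) * f (k + o)) := by positivity
  refine le_of_mul_le_mul_right ?_ hD
  rw [h, betaW] at *
  exact mul_le_mul_of_nonneg_left (by linarith) hP

/-- The tuples of a class over which the supremum in `gammaW` is taken. -/
abbrev LatencyTuple (C : Set (ℝ≥0 → ℝ≥0)) : Type :=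
  {t : (ℝ≥0 → ℝ≥0) × ℝ≥0 × ℝ≥0 // t.1 ∈ C ∧ 0 < t.2.1 ∧ 0 < t.2.2}

/-- Every value below the supremum for all `x ≥ 1` is attained by level costs: `m` levels with a
tuple along which they do not decrease are followed by `m'` levels with a tuple along which they do
not increase, both tuples being chosen for the same `x`. If `x = 1`, then `m = 0`. -/
theorem exists_isLevelData {C : Set (ℝ≥0 → ℝ≥0)} (hlat : ∀ f ∈ C, IsLatency f) (hC : C.Nonempty)
    {ε : ℝ≥0} {M : ℝ}
    (hM : ∀ x : ℝ, 1 ≤ x → ∃ f ∈ C, ∃ k > 0, ∃ o > 0, M < gammaWTuple ε x k o f) :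
    ∃ L ≥ 2, ∃ f k o, IsLevelData C L f k o ∧ ∀ n > 0,
      M * ∑ i ∈ Finset.range L, (levelChildCost ε n f k o i : ℝ) ≤
        ∑ i ∈ Finset.range L, (levelNashCost ε n f k o i : ℝ) := by
  have hgamma (x : ℝ) (k o : ℝ≥0) (f : ℝ≥0 → ℝ≥0) : gammaWTuple ε x k o f =
      k * f k / (o * f o) + x * (betaW ε k o f / (o * f o)) := by
    rw [gammaWTuple, add_div, mul_div_assoc x]
  have hD {f : ℝ≥0 → ℝ≥0} (hf : f ∈ C) {o : ℝ≥0} (ho : 0 < o) : 0 < (o : ℝ) * f o :=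
    mul_pos (by exact_mod_cast ho) (by exact_mod_cast (hlat f hf).pos o ho)
  obtain ⟨x, hx, ⟨⟨f₂, k₂, o₂⟩, hf₂, hk₂, ho₂⟩, ⟨⟨f₁, k₁, o₁⟩, hf₁, hk₁, ho₁⟩, ⟨hβ₂, hM₂⟩, hβ₁,
      hM₁⟩ := exists_multiplier (T := LatencyTuple C)
    (fun t => t.1.2.1 * t.1.1 t.1.2.1 / (t.1.2.2 * t.1.1 t.1.2.2))
    (fun t => betaW ε t.1.2.1 t.1.2.2 t.1.1 / (t.1.2.2 * t.1.1 t.1.2.2)) (M := M)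
    (fun x hx => by
      obtain ⟨f, hf, k, hk, o, ho, h⟩ := hM x hx
      exact ⟨⟨(f, k, o), hf, hk, ho⟩, by rwa [hgamma] at h⟩)
    (by
      obtain ⟨f, hf⟩ := hC
      -- Here `k f(k) ≤ f(k + o) / 2`, so `betaW` is positive.
      refine ⟨⟨(f, 1 / 2, 1), hf, by positivity, one_pos⟩, div_pos ?_ (hD hf one_pos)⟩
      have h1 : (f (1 / 2) : ℝ) ≤ f (1 / 2 + 1) := by
        exact_mod_cast (hlat f hf).mono le_self_add
      have h2 : (0 : ℝ) < f (1 / 2 + 1) := by exact_mod_cast (hlat f hf).pos _ (by positivity)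
      have h3 : 0 ≤ (ε : ℝ) * f (1 / 2 + 1) := by positivity
      simp only [betaW]
      push_cast
      linarith)
  dsimp only at hf₂ hk₂ ho₂ hf₁ hk₁ ho₁ hβ₂ hM₂ hβ₁ hM₁
  rw [← hgamma] at hM₁ hM₂
  replace hβ₂ : 0 ≤ betaW ε k₂ o₂ f₂ := by
    by_contra hneg
    exact absurd (div_neg_of_neg_of_pos (not_le.1 hneg) (hD hf₂ ho₂)) (not_lt.2 hβ₂)
  replace hβ₁ : x = 1 ∨ betaW ε k₁ o₁ f₁ ≤ 0 := by
    refine hβ₁.imp_right fun hle => ?_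
    by_contra hpos
    exact absurd (div_pos (not_le.1 hpos) (hD hf₁ ho₁)) (not_lt.2 hle)
  obtain ⟨δ₁, hδ₁, hstep₁⟩ := exists_step_slack (hlat f₁ hf₁) ho₁ hM₁
  obtain ⟨δ₂, hδ₂, hstep₂⟩ := exists_step_slack (hlat f₂ hf₂) ho₂ hM₂
  set δ := min δ₁ δ₂
  have hδ : 0 < δ := lt_min hδ₁ hδ₂
  obtain ⟨m, hm, hmβ⟩ : ∃ m : ℕ, x - 1 ≤ δ * m ∧ (m = 0 ∨ betaW ε k₁ o₁ f₁ ≤ 0) := by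
    rcases hβ₁ with rfl | hβ₁
    · exact ⟨0, by simp, Or.inl rfl⟩
    · obtain ⟨m, hm⟩ := exists_nat_ge ((x - 1) / δ)
      exact ⟨m, by rwa [div_le_iff₀' hδ] at hm, Or.inr hβ₁⟩
  obtain ⟨m', hm', hm'1⟩ : ∃ m' : ℕ, |M| ≤ δ * m' ∧ 1 ≤ m' := by
    obtain ⟨m', hm'⟩ := exists_nat_ge (max (|M| / δ) 1)
    refine ⟨m', ?_, by exact_mod_cast (le_max_right _ _).trans hm'⟩
    rw [← div_le_iff₀' hδ]
    exact (le_max_left _ _).trans hm'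
  set f : ℕ → ℝ≥0 → ℝ≥0 := fun i => if i ≤ m then f₁ else f₂ with hf
  set k : ℕ → ℝ≥0 := fun i => if i ≤ m then k₁ else if i ≤ m + m' then k₂ else 0 with hk
  set o : ℕ → ℝ≥0 := fun i => if i ≤ m then o₁ else o₂ with ho
  have hdata : IsLevelData C (m + m' + 1) f k o := by
    refine ⟨fun i => ?_, fun i => ?_, fun i hi => ?_, ?_⟩
    · simp only [hf]; split_ifs <;> assumption
    · simp only [ho]; split_ifs <;> assumption
    · simp only [hk]; split_ifs <;> first | assumption | omega
    · simp [hk, show ¬ m + m' + 1 ≤ m by omega]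
  refine ⟨m + m' + 1, by omega, f, k, o, hdata, fun n hn => ?_⟩
  have hsucc (i : ℕ) := congrArg NNReal.toReal (hdata.nashCost_succ (ε := ε) hlat hn i)
  have hchild (i : ℕ) := congrArg NNReal.toReal (hdata.childCost_mul (ε := ε) (n := n) hlat i)
  push_cast at hsucc hchild
  have hlow {i : ℕ} (hi : i < m) : f (i + 1) = f₁ ∧ k (i + 1) = k₁ ∧ o (i + 1) = o₁ := by
    simp [hf, hk, ho, Nat.succ_le_of_lt hi]
  have hhigh {i : ℕ} (hi : m ≤ i) (hi' : i < m + m') :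
      f (i + 1) = f₂ ∧ k (i + 1) = k₂ ∧ o (i + 1) = o₂ := by
    simp [hf, hk, ho, show ¬ i + 1 ≤ m by omega, show i + 1 ≤ m + m' by omega]
  have hP (i : ℕ) : (0 : ℝ) ≤ levelNashCost ε n f k o i := NNReal.coe_nonneg _
  refine mul_sum_le_sum_of_steps hP hx hδ.le (fun i hi => ?_) ?_ (fun i hi => ?_)
    (fun i hi hi' => ?_) hm hm'
  · have h1 := hsucc i
    have h2 := hchild i
    rcases lt_or_ge i m with him | him
    · obtain ⟨e1, e2, e3⟩ := hlow him
      rw [e1, e2, e3] at h1 h2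
      exact (add_le_add_right (mul_le_mul_of_nonneg_right (min_le_left _ _) (hP i)) _).trans
        (hstep₁ _ _ _ h1 h2)
    · obtain ⟨e1, e2, e3⟩ := hhigh him hi
      rw [e1, e2, e3] at h1 h2
      exact (add_le_add_right (mul_le_mul_of_nonneg_right (min_le_right _ _) (hP i)) _).trans
        (hstep₂ _ _ _ h1 h2)
  · -- As `k L = 0`, the leaves satisfy `(1 + ε) Q = P`.
    have h2 := hchild (m + m')
    rw [hdata.k_last, zero_add, ← mul_assoc] at h2
    have hfo : (0 : ℝ) < f (m + m' + 1) (o (m + m' + 1)) := by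
      exact_mod_cast (hlat _ (hdata.mem _)).pos _ (hdata.o_pos _)
    have h3 := mul_right_cancel₀ hfo.ne' h2
    have hQ : (0 : ℝ) ≤ levelChildCost ε n f k o (m + m') := NNReal.coe_nonneg _
    have h4 : 0 ≤ (levelChildCost ε n f k o (m + m') : ℝ) * ε := mul_nonneg hQ ε.2
    exact mul_le_mul (le_abs_self M) (by linarith) hQ (abs_nonneg M)
  · obtain ⟨e1, e2, e3⟩ := hlow hi
    have h1 := hsucc i
    rw [e1, e2, e3] at h1
    exact le_of_betaW_nonpos (hlat f₁ hf₁) ho₁ (hmβ.resolve_left (by omega)) (hP i) h1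
  · obtain ⟨e1, e2, e3⟩ := hhigh hi hi'
    have h1 := hsucc i
    rw [e1, e2, e3] at h1
    exact le_of_betaW_nonneg (hlat f₂ hf₂) ho₂ hβ₂ (hP i) h1

/-! ### The price of anarchy -/

theorem gammaW_le_of_forall_lt {ε : ℝ≥0} {G H : Set CongestionGame}
    (h : ∀ M : ℝ, (M : EReal) < gammaW ε G → ∃ Γ ∈ H, (M : EReal) ≤ Γ.approxPoA ε) :
    gammaW ε G ≤ classApproxPoA ε H := by
  refine EReal.ge_of_forall_gt_iff_ge.1 fun M hM => ?_
  obtain ⟨Γ, hΓ, hle⟩ := h M hM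
  exact hle.trans (le_iSup₂ (f := fun Γ (_ : Γ ∈ H) => Γ.approxPoA ε) Γ hΓ)

theorem theorem1 (C : Set (ℝ≥0 → ℝ≥0)) (hlat : ∀ f ∈ C, IsLatency f)
    (hnonconst : ∃ f ∈ C, ¬ IsConstantLatency f)
    (hord : ClosedUnderOrdinateScaling C) (habs : ClosedUnderAbscissaScaling C) (ε : ℝ≥0) :
    (gammaW ε (weightedGames C) = classApproxPoA ε (weightedGames C) ∧
      classApproxPoA ε (weightedGames C) = classApproxPoA ε (weightedLoadBalancingGames C)) ∧
    ((∀ f ∈ C, ¬ IsConstantLatency f → IsUnboundedLatency f) →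
      gammaW ε (weightedGames C) = classApproxPoA ε (weightedGames C) ∧
      classApproxPoA ε (weightedGames C) =
        classApproxPoA ε (weightedSymmetricLoadBalancingGames C)) := by
  have hupper := classApproxPoA_le_gammaW ε (weightedGames C)
  set C' : Set (ℝ≥0 → ℝ≥0) := {f | f ∈ C ∧ ¬ IsConstantLatency f} with hC'
  have hlat' : ∀ f ∈ C', IsLatency f := fun f hf => hlat f hf.1
  have hsub : C' ⊆ C := fun f hf => hf.1
  have hlevels (M : ℝ) (hM : (M : EReal) < gammaW ε (weightedGames C)) :=
    exists_isLevelData (M := M) (ε := ε) hlat' hnonconst fun x hx => by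
      obtain ⟨f, hf, hfc, h⟩ := exists_nonconstant_gammaWTuple_gt hlat hnonconst hM hx
      exact ⟨f, ⟨hf, hfc⟩, h⟩
  have hLB : gammaW ε (weightedGames C) ≤ classApproxPoA ε (weightedLoadBalancingGames C) := by
    refine gammaW_le_of_forall_lt fun M hM => ?_
    obtain ⟨L, hL, f, k, o, hdata, hcost⟩ := hlevels M hM
    -- Without symmetry a path is enough, that is, a tree with `n = 1`.
    obtain ⟨Γ, hΓ, -, hle⟩ := hdata.le_approxPoA hlat' hL one_pos (hcost 1 one_pos) hsub hlat hord
      habs (fun p => {p.parent, p.child}) (fun p => Or.inl rfl) (fun p => Or.inr rfl) (by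
        rintro p r (rfl | rfl)
        · exact hdata.cost_le_deviation_of_le hlat' one_pos p.1.2.le le_rfl _
        · exact (hdata.cost_eq_deviation hlat' one_pos p.1.2).le)
    exact ⟨Γ, hΓ, hle⟩
  have hmono := classApproxPoA_mono ε (G := weightedLoadBalancingGames C)
    (H := weightedGames C) fun Γ hΓ => hΓ.1
  have heq := le_antisymm (hLB.trans hmono) hupper
  refine ⟨⟨heq, le_antisymm (hupper.trans hLB) hmono⟩, fun hunb => ⟨heq, ?_⟩⟩
  refine le_antisymm (hupper.trans ?_) (classApproxPoA_mono ε fun Γ hΓ => hΓ.1)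
  refine gammaW_le_of_forall_lt fun M hM => ?_
  obtain ⟨L, hL, f, k, o, hdata, hcost⟩ := hlevels M hM
  obtain ⟨n, hn, hdev⟩ := hdata.exists_cost_le_deviation hlat' (fun f hf => hunb f hf.1 hf.2) ε
  obtain ⟨Γ, hΓ, hsymm, hle⟩ := hdata.le_approxPoA hlat' hL hn (hcost n hn) hsub hlat hord
    habs (fun _ => Set.univ) (fun _ => trivial) (fun _ => trivial)
    fun p r _ => hdev _ p.1.2 _ (Nat.lt_succ_iff.1 r.1.2)
  exact ⟨Γ, ⟨hΓ.1, hΓ.2, hsymm fun _ => rfl⟩, hle⟩
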